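/- **Setting.** Let $\mathbb X$ be a compact metric space (e.g. a compact subset of $\mathbb R^m$) with its Borel $\sigma$-algebra, $\mathbb Y$ a measurable space (e.g. a Borel subset of $\mathbb R^k$) and $\mathbb U$ a finite set with the discrete topology. A POMDP consists of a transition kernel $\mathcal T(dx'|x,u)$ from $\mathbb X\times\mathbb U$ to $\mathbb X$, an observation channel $O(dy|x)$ from $\mathbb X$ to $\mathbb Y$ (both stochastic kernels) and a measurable stage cost $c:\mathbb X\times\mathbb U\to\mathbb R$. An admissible policy $\gamma=(\gamma_t)_{t\ge 0}$ chooses $U_t=\gamma_t(Y_0,\dots,Y_t,U_0,\dots,U_{t-1})$ with each $\gamma_t$ measurable; $\Gamma$ is the set of admissible policies. Given a prior $\mu_0$ on $\mathbb X$, let $X_0\sim\mu_0$, $Y_0\sim O(\cdot|X_0)$ and, given the past up to time $t$, $X_{t+1}\sim\mathcal T(\cdot|X_t,U_t)$, $Y_{t+1}\sim O(\cdot|X_{t+1})$. For $\beta\in(0,1)$ put $$J_\beta(\mu_0,\gamma)=\sum_{t=0}^\infty\beta^t E^\gamma_{\mu_0}[c(X_t,U_t)],\qquad J_\beta^*(\mu_0)=\inf_{\gamma\in\Gamma}J_\beta(\mu_0,\gamma).$$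 **Discretized models.** For every integer $n\ge1$ let $\hat{\mathbb X}_n=\{x_{n,1},\dots,x_{n,k_n}\}\subset\mathbb X$ be a finite $1/n$-net, i.e. $\min_i d(x,x_{n,i})<1/n$ for all $x\in\mathbb X$, and let $A_{n,1},\dots,A_{n,k_n}$ be a measurable partition of $\mathbb X$ into nearest-neighbour cells: $d(x,x_{n,i})=\min_j d(x,x_{n,j})$ for $x\in A_{n,i}$ (ties broken arbitrarily). Let $\psi_n(x)=x_{n,i}$ for $x\in A_{n,i}$, let $\pi_n$ be a probability measure on $\mathbb X$ with $\pi_n(A_{n,i})>0$ for all $i$ (for instance one and the same measure for all $n$), and let $\pi_{n,i}=\pi_n(\cdot\cap A_{n,i})/\pi_n(A_{n,i})$. The $n$-th hidden-state-discretized model is the POMDP with hidden state space $\hat{\mathbb X}_n$, the same $\mathbb U$, $\mathbb Y$ and policies $\Gamma$, prior $\mu_0\circ\psi_n^{-1}$, and $$\hat{\mathcal T}_n(x_{n,j}|x_{n,i},u)=\int\mathcal T(A_{n,j}|z,u)\,\pi_{n,i}(dz),\quad \hat O_n(\cdot|x_{n,i})=\int O(\cdot|z)\,\pi_{n,i}(dz),\quad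 \hat c_n(x_{n,i},u)=\int c(z,u)\,\pi_{n,i}(dz).$$ Let $\hat\gamma_n\in\Gamma$ be any optimal policy of this model, i.e. one that minimizes its discounted cost over $\Gamma$. **Theorem.** Assume that (i) $c$ is continuous in $(x,u)$; (ii) $\mathcal T(\cdot|x,u)$ is weakly continuous in $(x,u)$; (iii) $O(\cdot|x)$ is continuous in $x$ in total variation; and that $\|c\|_\infty\le C$ for some $C<\infty$. Then $$J_\beta(\mu_0,\hat\gamma_n)\longrightarrow J_\beta^*(\mu_0)\qquad(n\to\infty).$$ -/

import Mathlib

open MeasureTheory ProbabilityTheory Filter Topology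

/-- A partially observed Markov decision process with hidden states `X`, actions `U` and
observations `Y`: a transition kernel `T(dx' | x, u)`, an observation channel `O(dy | x)` and a
measurable stage cost `c(x, u)`. -/
structure POMDP (X U Y : Type*) [MeasurableSpace X] [MeasurableSpace U] [MeasurableSpace Y] where
  trans : Kernel (X × U) X
  [markov_trans : IsMarkovKernel trans]
  chan : Kernel X Y
  [markov_chan : IsMarkovKernel chan]
  cost : X × U → ℝ
  measurable_cost : Measurable cost

attribute [instance] POMDP.markov_trans POMDP.markov_chan

/-- An admissible policy: at time `t` the action is a measurable function of the information
`I_t = (Y_0, …, Y_t, U_0, …, U_{t-1})`. -/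
structure AdmissiblePolicy (Y U : Type*) [MeasurableSpace Y] [MeasurableSpace U] where
  act : ∀ t : ℕ, (Fin (t + 1) → Y) × (Fin t → U) → U
  measurable_act : ∀ t, Measurable (act t)

/-- Trajectories up to time `t`: `(X_0, …, X_t)` together with the information
`I_t = ((Y_0, …, Y_t), (U_0, …, U_{t-1}))`. -/
abbrev Trajectory (X U Y : Type*) (t : ℕ) : Type _ :=
  (Fin (t + 1) → X) × ((Fin (t + 1) → Y) × (Fin t → U))

namespace POMDP

variable {X U Y : Type*} [MeasurableSpace X] [MeasurableSpace U] [MeasurableSpace Y]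

/-- `T(· | x, u)` as an element of the space of probability measures, which carries the topology
of weak convergence. -/
def transLaw (M : POMDP X U Y) (p : X × U) : ProbabilityMeasure X :=
  ⟨M.trans p, inferInstance⟩

/-- The conditional law of `(X_{t+1}, Y_{t+1})` given the trajectory up to time `t` under the
policy `γ`: first `X_{t+1} ∼ T(· | X_t, U_t)` with `U_t = γ_t(I_t)`, then
`Y_{t+1} ∼ O(· | X_{t+1})`. -/
noncomputable def stepKernel (M : POMDP X U Y) (γ : AdmissiblePolicy Y U) (t : ℕ) :
    Kernel (Trajectory X U Y t) (X × Y) :=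
  Kernel.compProd
    (M.trans.comap (fun ω : Trajectory X U Y t => (ω.1 (Fin.last t), γ.act t ω.2))
      (((measurable_pi_apply _).comp measurable_fst).prodMk
        ((γ.measurable_act t).comp measurable_snd)))
    (Kernel.prodMkLeft (Trajectory X U Y t) M.chan)

/-- The trajectory at time `0` made of `X_0` and `Y_0`. -/
def initTrajectory (p : X × Y) : Trajectory X U Y 0 :=
  (fun _ => p.1, (fun _ => p.2, fun i => i.elim0))

/-- Append the action `U_t = γ_t(I_t)` and the new pair `(X_{t+1}, Y_{t+1})` to a trajectory. -/
def extendTrajectory (γ : AdmissiblePolicy Y U) (t : ℕ)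
    (p : Trajectory X U Y t × (X × Y)) : Trajectory X U Y (t + 1) :=
  (Fin.snoc (α := fun _ => X) p.1.1 p.2.1,
    (Fin.snoc (α := fun _ => Y) p.1.2.1 p.2.2,
      Fin.snoc (α := fun _ => U) p.1.2.2 (γ.act t p.1.2)))

/-- The law of `(X_{[0,t]}, Y_{[0,t]}, U_{[0,t-1]})` when `X_0 ∼ μ` and the policy `γ` is used. -/
noncomputable def law (M : POMDP X U Y) (μ : Measure X) (γ : AdmissiblePolicy Y U) :
    ∀ t : ℕ, Measure (Trajectory X U Y t)
  | 0 => (μ.compProd M.chan).map initTrajectory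
  | t + 1 => ((M.law μ γ t).compProd (M.stepKernel γ t)).map (extendTrajectory γ t)

/-- The expected stage cost `E_μ^γ[c(X_t, U_t)]`, where `U_t = γ_t(I_t)`. -/
noncomputable def expectedCost (M : POMDP X U Y) (μ : Measure X) (γ : AdmissiblePolicy Y U)
    (t : ℕ) : ℝ :=
  ∫ ω, M.cost (ω.1 (Fin.last t), γ.act t ω.2) ∂(M.law μ γ t)

/-- The infinite horizon discounted cost `J_β(μ, γ) = ∑ₜ βᵗ E_μ^γ[c(X_t, U_t)]`. -/
noncomputable def discountedCost (M : POMDP X U Y) (β : ℝ) (μ : Measure X)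
    (γ : AdmissiblePolicy Y U) : ℝ :=
  ∑' t : ℕ, β ^ t * M.expectedCost μ γ t

/-- The optimal cost `J*_β(μ) = inf_γ J_β(μ, γ)` over all admissible policies. -/
noncomputable def optimalCost (M : POMDP X U Y) (β : ℝ) (μ : Measure X) : ℝ :=
  ⨅ γ : AdmissiblePolicy Y U, M.discountedCost β μ γ

/-- `γ` is an optimal policy for the model `M` with prior `μ`. -/
def IsOptimal (M : POMDP X U Y) (β : ℝ) (μ : Measure X) (γ : AdmissiblePolicy Y U) : Prop :=
  ∀ γ' : AdmissiblePolicy Y U, M.discountedCost β μ γ ≤ M.discountedCost β μ γ'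

theorem measurable_snoc {Z : Type*} [MeasurableSpace Z] (t : ℕ) :
    Measurable (fun p : (Fin t → Z) × Z => (Fin.snoc (α := fun _ => Z) p.1 p.2 : Fin (t + 1) → Z)) := by
  refine measurable_pi_iff.2 fun i => ?_
  refine Fin.lastCases ?_ (fun j => ?_) i
  · simpa using measurable_snd
  · simp only [Fin.snoc_castSucc]
    exact (measurable_pi_apply j).comp measurable_fst

theorem measurable_initTrajectory :
    Measurable (initTrajectory : X × Y → Trajectory X U Y 0) := by
  refine (measurable_pi_lambda _ fun _ => measurable_fst).prodMk
    ((measurable_pi_lambda _ fun _ => measurable_snd).prodMk measurable_const)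

theorem measurable_extendTrajectory (γ : AdmissiblePolicy Y U) (t : ℕ) :
    Measurable (extendTrajectory (X := X) γ t) := by
  have h := γ.measurable_act t
  refine ((measurable_snoc (t + 1)).comp (?_ : Measurable fun p : Trajectory X U Y t × (X × Y) =>
      (p.1.1, p.2.1))).prodMk
    (((measurable_snoc (t + 1)).comp (?_ : Measurable fun p : Trajectory X U Y t × (X × Y) =>
      (p.1.2.1, p.2.2))).prodMk
    ((measurable_snoc t).comp (?_ : Measurable fun p : Trajectory X U Y t × (X × Y) =>
      (p.1.2.2, γ.act t p.1.2)))) <;> fun_prop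

instance isMarkovKernel_stepKernel (M : POMDP X U Y) (γ : AdmissiblePolicy Y U) (t : ℕ) :
    IsMarkovKernel (M.stepKernel γ t) := by
  unfold stepKernel; infer_instance

instance isProbabilityMeasure_law (M : POMDP X U Y) (μ : Measure X) [IsProbabilityMeasure μ]
    (γ : AdmissiblePolicy Y U) (t : ℕ) : IsProbabilityMeasure (M.law μ γ t) := by
  induction t with
  | zero => exact Measure.isProbabilityMeasure_map measurable_initTrajectory.aemeasurable
  | succ t ih =>
    exact Measure.isProbabilityMeasure_map (measurable_extendTrajectory γ t).aemeasurable

end POMDP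

/-- The total variation norm `‖μ - ν‖_TV` of the difference of two finite measures. -/
noncomputable def tvNorm {Y : Type*} [MeasurableSpace Y] (μ ν : Measure Y)
    [IsFiniteMeasure μ] [IsFiniteMeasure ν] : ℝ :=
  (μ.toSignedMeasure - ν.toSignedMeasure).totalVariation.real Set.univ

/-- A quantization of the state space `X`: a finite set of points `X̂`, a measurable map
`ψ : X → X̂`, whose fibres `A_i = ψ⁻¹{i}` are the (disjoint, covering) cells, and a weighting
probability measure `π` that charges every cell. -/
structure Quantization (X : Type*) [MeasurableSpace X] where
  points : Finset X
  toPoint : X → points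
  measurable_toPoint : Measurable toPoint
  weight : Measure X
  [prob_weight : IsProbabilityMeasure weight]
  weight_cell_ne_zero : ∀ i, weight (toPoint ⁻¹' {i}) ≠ 0

attribute [instance] Quantization.prob_weight

namespace Quantization

/-- The points of the quantization form an `ε`-net: every state is at distance less than `ε` from
one of them. -/
def IsNet {X : Type*} [MetricSpace X] [MeasurableSpace X] (Q : Quantization X) (ε : ℝ) : Prop :=
  ∀ x : X, ∃ p ∈ Q.points, dist x p < ε

/-- The cells are nearest neighbour cells (ties may be broken arbitrarily). -/
def IsNearestNeighbor {X : Type*} [MetricSpace X] [MeasurableSpace X] (Q : Quantization X) :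
    Prop :=
  ∀ x : X, ∀ p ∈ Q.points, dist x (Q.toPoint x) ≤ dist x p

variable {X : Type*} [MeasurableSpace X]

/-- The normalized restriction `π_i = π(· ∩ A_i) / π(A_i)` of the weighting measure to the cell
`A_i` of the point `i`. -/
noncomputable def cellMeasure (Q : Quantization X) (i : Q.points) : Measure X :=
  Q.weight[|Q.toPoint ⁻¹' {i}]

instance isProbabilityMeasure_cellMeasure (Q : Quantization X) (i : Q.points) :
    IsProbabilityMeasure (Q.cellMeasure i) :=
  cond_isProbabilityMeasure (Q.weight_cell_ne_zero i)

variable {U Y : Type*} [MeasurableSpace U] [MeasurableSpace Y]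

/-- The hidden-state-discretized model, with the finite hidden state space `X̂` and
`T̂(· | i, u) = ∫ T(ψ⁻¹(·) | z, u) π_i(dz)`, `Ô(· | i) = ∫ O(· | z) π_i(dz)` and
`ĉ(i, u) = ∫ c(z, u) π_i(dz)`. -/
noncomputable def discretize [MeasurableSingletonClass X] [Finite U] [MeasurableSingletonClass U]
    (Q : Quantization X) (M : POMDP X U Y) : POMDP Q.points U Y where
  trans := Kernel.ofFunOfCountable fun p =>
    ((Q.cellMeasure p.1).bind fun z => M.trans (z, p.2)).map Q.toPoint
  markov_trans := ⟨fun p => by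
    have hm : Measurable fun z => M.trans (z, p.2) :=
      M.trans.measurable.comp (measurable_id.prodMk measurable_const)
    have : IsProbabilityMeasure ((Q.cellMeasure p.1).bind fun z => M.trans (z, p.2)) :=
      isProbabilityMeasure_bind hm.aemeasurable (.of_forall fun z => inferInstance)
    exact Measure.isProbabilityMeasure_map Q.measurable_toPoint.aemeasurable⟩
  chan := Kernel.ofFunOfCountable fun i => (Q.cellMeasure i).bind M.chan
  markov_chan := ⟨fun i =>
    isProbabilityMeasure_bind M.chan.measurable.aemeasurable
      (.of_forall fun z => inferInstance)⟩
  cost := fun p => ∫ z, M.cost (z, p.2) ∂(Q.cellMeasure p.1)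
  measurable_cost := measurable_of_finite _

end Quantization

/-! The discounted costs of the discretized models converge to those of the original model uniformly
over all admissible policies. A policy that is optimal for a model whose costs are within `ε / 3` of
the true ones is then within `2 * (ε / 3)` of the optimum, whatever the policy is.

For uniform convergence the cost is truncated after `k` stages, with a tail that is uniform in the
policy and in the model. The truncated cost is an average of `costToGo`, the cost of a fixed policy
given the hidden state `x` and the information `h`. No belief filter is needed: the action depends
on `h` only, so `x` and a nearby `x'` are compared under the same action.

The costs to go are uniformly equicontinuous in `x`, uniformly over policies and information
(`uniformEquicontinuous_costToGo`). Averaging over the observation preserves this because total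
variation continuity controls all bounded measurable integrands at once; averaging over the next
state does because, by Arzelà–Ascoli, an equicontinuous bounded family reduces weak continuity to
finitely many test functions (`equicontinuous_integral_of_continuous`). With this regularity,
replacing a state by the average over its small cell costs little at each stage, and induction on
`k` gives `exists_isFine_abs_costToGo_sub_le`. -/

/-! ### Total variation, weak continuity and equicontinuous families. -/

/-- A function on `Y` that is measurable and bounded by `B`. -/
abbrev BoundedMeasurable (Y : Type*) [MeasurableSpace Y] (B : ℝ) : Type _ :=
  {f : Y → ℝ // Measurable f ∧ ∀ y, |f y| ≤ B}

theorem integrable_of_abs_le {α : Type*} [MeasurableSpace α] {μ : Measure α} [IsFiniteMeasure μ]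
    {f : α → ℝ} (hf : Measurable f) {B : ℝ} (hB : ∀ a, |f a| ≤ B) : Integrable f μ :=
  Integrable.of_bound hf.aestronglyMeasurable B (.of_forall hB)

theorem abs_integral_le_of_abs_le {α : Type*} [MeasurableSpace α] {μ : Measure α}
    [IsProbabilityMeasure μ] {f : α → ℝ} {B : ℝ} (hB : ∀ a, |f a| ≤ B) : |∫ a, f a ∂μ| ≤ B := by
  simpa using norm_integral_le_of_norm_le_const (μ := μ) (f := f) (C := B) (.of_forall hB)

theorem abs_integral_sub_integral_le {α : Type*} [MeasurableSpace α] {μ : Measure α}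
    [IsProbabilityMeasure μ] {f g : α → ℝ} (hf : Integrable f μ) (hg : Integrable g μ)
    {B : ℝ} (hB : ∀ a, |f a - g a| ≤ B) : |∫ a, f a ∂μ - ∫ a, g a ∂μ| ≤ B := by
  rw [← integral_sub hf hg]
  exact abs_integral_le_of_abs_le hB

/-- Integrals of a bounded function differ by at most the bound times the total variation. -/
theorem abs_integral_sub_le_mul_tvNorm {Y : Type*} [MeasurableSpace Y] (μ ν : Measure Y)
    [IsFiniteMeasure μ] [IsFiniteMeasure ν] {f : Y → ℝ} (hf : Measurable f) {B : ℝ}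
    (hB : ∀ y, |f y| ≤ B) :
    |∫ y, f y ∂μ - ∫ y, f y ∂ν| ≤ B * tvNorm μ ν := by
  set s := μ.toSignedMeasure - ν.toSignedMeasure with hs
  set p := s.toJordanDecomposition.posPart
  set q := s.toJordanDecomposition.negPart
  -- The Jordan decomposition of `μ - ν`, rearranged into an identity between positive measures so
  -- that integrals can be added.
  have h : μ + q = ν + p := by
    refine Measure.toSignedMeasure_eq_toSignedMeasure_iff.1 ?_
    rw [Measure.toSignedMeasure_add, Measure.toSignedMeasure_add]
    have h1 : s = p.toSignedMeasure - q.toSignedMeasure :=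
      (SignedMeasure.toSignedMeasure_toJordanDecomposition s).symm
    rw [add_comm ν.toSignedMeasure]
    exact sub_eq_sub_iff_add_eq_add.1 (hs.symm.trans h1)
  have hi : ∀ (m : Measure Y) [IsFiniteMeasure m], Integrable f m :=
    fun m _ => integrable_of_abs_le hf hB
  have h2 : ∫ y, f y ∂μ + ∫ y, f y ∂q = ∫ y, f y ∂ν + ∫ y, f y ∂p := by
    rw [← integral_add_measure (hi μ) (hi q), ← integral_add_measure (hi ν) (hi p), h]
  have h3 : ∀ (m : Measure Y) [IsFiniteMeasure m], |∫ y, f y ∂m| ≤ B * m.real Set.univ :=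
    fun m _ => by
      simpa using norm_integral_le_of_norm_le_const (μ := m) (f := f) (C := B) (.of_forall hB)
  have h4 : tvNorm μ ν = p.real Set.univ + q.real Set.univ := by
    rw [tvNorm, ← hs, SignedMeasure.totalVariation, measureReal_add_apply]
  have h5 : ∫ y, f y ∂μ - ∫ y, f y ∂ν = ∫ y, f y ∂p - ∫ y, f y ∂q := by linarith
  rw [h5, h4, mul_add]
  exact (abs_sub _ _).trans (add_le_add (h3 p) (h3 q))

/-- Integration of bounded functions against a kernel that is continuous in total variation. -/
theorem uniformEquicontinuous_integral_kernel {X Y : Type*} [MetricSpace X] [CompactSpace X]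
    [MeasurableSpace X] [MeasurableSpace Y] (κ : Kernel X Y) [IsMarkovKernel κ]
    (hκ : ∀ x, Tendsto (fun x' => tvNorm (κ x') (κ x)) (𝓝 x) (𝓝 0)) (B : ℝ) :
    UniformEquicontinuous (fun (f : BoundedMeasurable Y B) x => ∫ y, f.1 y ∂(κ x)) := by
  refine CompactSpace.uniformEquicontinuous_of_equicontinuous fun x => ?_
  -- The modulus does not involve `f`, which gives equicontinuity of the whole class.
  refine Metric.equicontinuousAt_of_continuity_modulus
    (fun x' => B * tvNorm (κ x') (κ x)) ?_ _ (.of_forall fun x' f => ?_)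
  · simpa using (hκ x).const_mul B
  · rw [dist_comm]
    exact abs_integral_sub_le_mul_tvNorm _ _ f.2.1 f.2.2

/-- A uniformly bounded, equicontinuous family of functions on a compact space is uniformly
approximated by finitely many continuous functions. -/
theorem exists_finite_approx_of_equicontinuous {ι X : Type*} [TopologicalSpace X] [CompactSpace X]
    {F : ι → X → ℝ} (hF : Equicontinuous F) {B : ℝ} (hB : ∀ i x, |F i x| ≤ B)
    {ε : ℝ} (hε : 0 < ε) :
    ∃ S : Set (BoundedContinuousFunction X ℝ), S.Finite ∧
      ∀ i, ∃ g ∈ S, ∀ x, |F i x - g x| < ε := by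
  let G : ι → BoundedContinuousFunction X ℝ := fun i =>
    BoundedContinuousFunction.mkOfCompact ⟨F i, hF.continuous i⟩
  have hGc : IsCompact (closure (Set.range G)) := by
    refine BoundedContinuousFunction.arzela_ascoli (Set.Icc (-B) B) isCompact_Icc _ ?_ ?_
    · rintro _ x ⟨i, rfl⟩
      exact abs_le.1 (hB i x)
    · intro x U hU
      filter_upwards [hF x U hU] with x' hx'
      rintro ⟨_, i, rfl⟩
      exact hx' i
  obtain ⟨S, hS, hcov⟩ := Metric.totallyBounded_iff.1 hGc.totallyBounded ε hε
  refine ⟨S, hS, fun i => ?_⟩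
  obtain ⟨g, hg, hi⟩ := Set.mem_iUnion₂.1 (hcov (subset_closure ⟨i, rfl⟩))
  exact ⟨g, hg, fun x => (BoundedContinuousFunction.dist_coe_le_dist x).trans_lt hi⟩

/-- A weakly continuous family of probability measures maps a uniformly bounded equicontinuous
family of functions to an equicontinuous family. -/
theorem equicontinuous_integral_of_continuous {ι X Z : Type*} [MetricSpace X] [CompactSpace X]
    [MeasurableSpace X] [BorelSpace X] [TopologicalSpace Z]
    {P : Z → ProbabilityMeasure X} (hP : Continuous P)
    {F : ι → X → ℝ} (hF : Equicontinuous F) {B : ℝ} (hB : ∀ i x, |F i x| ≤ B) :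
    Equicontinuous (fun i z => ∫ x, F i x ∂(P z : Measure X)) := by
  intro z
  rw [Metric.equicontinuousAt_iff_right]
  intro ε hε
  obtain ⟨S, hS, hFS⟩ := exists_finite_approx_of_equicontinuous hF hB (ε := ε / 3) (by positivity)
  -- Weak convergence treats one test function at a time; finiteness of `S` yields one neighbourhood
  -- for all `i`.
  have hev : ∀ g ∈ S, ∀ᶠ z' in 𝓝 z,
      dist (∫ x, g x ∂(P z' : Measure X)) (∫ x, g x ∂(P z : Measure X)) < ε / 3 := fun g _ =>
    Metric.tendsto_nhds.1
      (ProbabilityMeasure.tendsto_iff_forall_integral_tendsto.1 (hP.tendsto z) g) _ (by positivity)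
  filter_upwards [(eventually_all_finite hS).2 hev] with z' hz' i
  obtain ⟨g, hg, hi⟩ := hFS i
  have hFi : Measurable (F i) := (hF.continuous i).measurable
  have key : ∀ w, |∫ x, F i x ∂(P w : Measure X) - ∫ x, g x ∂(P w : Measure X)| ≤ ε / 3 :=
    fun w => abs_integral_sub_integral_le (integrable_of_abs_le hFi (hB i)) (g.integrable _)
      fun x => (hi x).le
  have h1 := abs_le.1 (key z)
  have h2 := abs_le.1 (key z')
  have h3 := abs_lt.1 (Real.dist_eq _ _ ▸ hz' g hg)
  rw [Real.dist_eq, abs_lt]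
  constructor <;> linarith [h1.1, h1.2, h2.1, h2.2, h3.1, h3.2]

/-! ### Costs to go of a fixed policy: measurability and bounds. -/

namespace AdmissiblePolicy

variable {U Y : Type*} [MeasurableSpace U] [MeasurableSpace Y]

/-- The information `I_{t+1}` obtained from `I_t` when the policy acts and `y` is observed. -/
def extendInfo (γ : AdmissiblePolicy Y U) (t : ℕ) (h : (Fin (t + 1) → Y) × (Fin t → U)) (y : Y) :
    (Fin (t + 1 + 1) → Y) × (Fin (t + 1) → U) :=
  (Fin.snoc (α := fun _ => Y) h.1 y, Fin.snoc (α := fun _ => U) h.2 (γ.act t h))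

theorem measurable_extendInfo (γ : AdmissiblePolicy Y U) (t : ℕ) :
    Measurable fun p : ((Fin (t + 1) → Y) × (Fin t → U)) × Y => γ.extendInfo t p.1 p.2 := by
  have h := γ.measurable_act t
  exact ((POMDP.measurable_snoc (t + 1)).comp (f := fun p : ((Fin (t + 1) → Y) × (Fin t → U)) × Y =>
      (p.1.1, p.2)) (by fun_prop)).prodMk
    ((POMDP.measurable_snoc t).comp (f := fun p : ((Fin (t + 1) → Y) × (Fin t → U)) × Y =>
      (p.1.2, γ.act t p.1)) (by fun_prop))

end AdmissiblePolicy

namespace POMDP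

variable {X U Y : Type*} [MeasurableSpace X] [MeasurableSpace U] [MeasurableSpace Y]

/-- The discounted cost of the next `k` stages under the policy `γ`, given the information at
time `t` and the hidden state at time `t`. -/
noncomputable def costToGo (M : POMDP X U Y) (β : ℝ) (γ : AdmissiblePolicy Y U) :
    ℕ → ∀ t : ℕ, (Fin (t + 1) → Y) × (Fin t → U) → X → ℝ
  | 0, _, _, _ => 0
  | k + 1, t, h, x => M.cost (x, γ.act t h) + β *
      ∫ x', ∫ y, M.costToGo β γ k (t + 1) (γ.extendInfo t h y) x' ∂(M.chan x')
        ∂(M.trans (x, γ.act t h))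

/-- The discounted cost of the next `k` stages, before the observation at time `t + 1` is made. -/
noncomputable def costToGoUnobserved (M : POMDP X U Y) (β : ℝ) (γ : AdmissiblePolicy Y U)
    (k t : ℕ) (h : (Fin (t + 1) → Y) × (Fin t → U)) (x' : X) : ℝ :=
  ∫ y, M.costToGo β γ k (t + 1) (γ.extendInfo t h y) x' ∂(M.chan x')

theorem costToGo_succ (M : POMDP X U Y) (β : ℝ) (γ : AdmissiblePolicy Y U) (k t : ℕ)
    (h : (Fin (t + 1) → Y) × (Fin t → U)) (x : X) :
    M.costToGo β γ (k + 1) t h x = M.cost (x, γ.act t h) + β *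
      ∫ x', M.costToGoUnobserved β γ k t h x' ∂(M.trans (x, γ.act t h)) := rfl

/-- Conditional on measurability of `costToGo`, so that it can serve inside the induction proving
the latter. -/
theorem measurable_costToGoUnobserved_of (M : POMDP X U Y) (β : ℝ) (γ : AdmissiblePolicy Y U)
    (k t : ℕ) (hk : Measurable fun p : X × ((Fin (t + 1 + 1) → Y) × (Fin (t + 1) → U)) =>
      M.costToGo β γ k (t + 1) p.2 p.1) :
    Measurable fun p : X × ((Fin (t + 1) → Y) × (Fin t → U)) =>
      M.costToGoUnobserved β γ k t p.2 p.1 := by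
  have h1 : Measurable fun q : (X × ((Fin (t + 1) → Y) × (Fin t → U))) × Y =>
      M.costToGo β γ k (t + 1) (γ.extendInfo t q.1.2 q.2) q.1.1 :=
    hk.comp ((measurable_fst.comp measurable_fst).prodMk ((γ.measurable_extendInfo t).comp
      ((measurable_snd.comp measurable_fst).prodMk measurable_snd)))
  exact (h1.stronglyMeasurable.integral_kernel_prod_right'
    (κ := M.chan.comap Prod.fst measurable_fst)).measurable

theorem measurable_costToGo (M : POMDP X U Y) (β : ℝ) (γ : AdmissiblePolicy Y U) (k t : ℕ) :
    Measurable fun p : X × ((Fin (t + 1) → Y) × (Fin t → U)) => M.costToGo β γ k t p.2 p.1 := by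
  induction k generalizing t with
  | zero => exact measurable_const
  | succ k ih =>
    have hm : Measurable fun p : X × ((Fin (t + 1) → Y) × (Fin t → U)) => (p.1, γ.act t p.2) :=
      measurable_fst.prodMk ((γ.measurable_act t).comp measurable_snd)
    have h2 : Measurable fun q : (X × ((Fin (t + 1) → Y) × (Fin t → U))) × X =>
        M.costToGoUnobserved β γ k t q.1.2 q.2 :=
      (M.measurable_costToGoUnobserved_of β γ k t (ih (t + 1))).comp
        (measurable_snd.prodMk (measurable_snd.comp measurable_fst))
    exact (M.measurable_cost.comp hm).add (measurable_const.mul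
      (h2.stronglyMeasurable.integral_kernel_prod_right'
        (κ := M.trans.comap _ hm)).measurable)

theorem measurable_costToGoUnobserved (M : POMDP X U Y) (β : ℝ) (γ : AdmissiblePolicy Y U)
    (k t : ℕ) : Measurable fun p : X × ((Fin (t + 1) → Y) × (Fin t → U)) =>
      M.costToGoUnobserved β γ k t p.2 p.1 :=
  M.measurable_costToGoUnobserved_of β γ k t (M.measurable_costToGo β γ k (t + 1))

theorem measurable_costToGoUnobserved_state (M : POMDP X U Y) (β : ℝ)
    (γ : AdmissiblePolicy Y U) (k t : ℕ) (h : (Fin (t + 1) → Y) × (Fin t → U)) :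
    Measurable (M.costToGoUnobserved β γ k t h) :=
  (M.measurable_costToGoUnobserved β γ k t).comp (measurable_id.prodMk measurable_const)

theorem measurable_costToGo_extendInfo (M : POMDP X U Y) (β : ℝ) (γ : AdmissiblePolicy Y U)
    (k t : ℕ) (h : (Fin (t + 1) → Y) × (Fin t → U)) (x : X) :
    Measurable fun y => M.costToGo β γ k (t + 1) (γ.extendInfo t h y) x :=
  (M.measurable_costToGo β γ k (t + 1)).comp (measurable_const.prodMk
    ((γ.measurable_extendInfo t).comp (measurable_const.prodMk measurable_id)))

/-- A crude bound that forgets the discounting; it suffices because `k` is fixed and only uniformity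
in policy, information and state matters. -/
theorem abs_costToGo_le (M : POMDP X U Y) {β : ℝ} (hβ₀ : 0 ≤ β) (hβ₁ : β ≤ 1) {C : ℝ}
    (hC : ∀ p, |M.cost p| ≤ C) (γ : AdmissiblePolicy Y U) (k t : ℕ)
    (h : (Fin (t + 1) → Y) × (Fin t → U)) (x : X) :
    |M.costToGo β γ k t h x| ≤ k * C := by
  induction k generalizing t x with
  | zero => simp [costToGo]
  | succ k ih =>
    have h1 : ∀ x', |M.costToGoUnobserved β γ k t h x'| ≤ k * C := fun x' =>
      abs_integral_le_of_abs_le fun y => ih (t + 1) _ _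
    have h2 := abs_integral_le_of_abs_le (μ := M.trans (x, γ.act t h)) h1
    rw [costToGo_succ]
    refine (abs_add_le _ _).trans ?_
    rw [abs_mul, abs_of_nonneg hβ₀]
    push_cast
    have h3 := hC (x, γ.act t h)
    have h4 := mul_le_of_le_one_left (abs_nonneg
      (∫ x', M.costToGoUnobserved β γ k t h x' ∂(M.trans (x, γ.act t h)))) hβ₁
    linarith

theorem abs_costToGoUnobserved_le (M : POMDP X U Y) {β : ℝ} (hβ₀ : 0 ≤ β) (hβ₁ : β ≤ 1) {C : ℝ}
    (hC : ∀ p, |M.cost p| ≤ C) (γ : AdmissiblePolicy Y U) (k t : ℕ)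
    (h : (Fin (t + 1) → Y) × (Fin t → U)) (x : X) :
    |M.costToGoUnobserved β γ k t h x| ≤ k * C :=
  abs_integral_le_of_abs_le fun _ => M.abs_costToGo_le hβ₀ hβ₁ hC γ k (t + 1) _ _

end POMDP

/-! ### Truncated discounted costs as integrals of costs to go. -/

namespace POMDP

variable {X U Y : Type*} [MeasurableSpace X] [MeasurableSpace U] [MeasurableSpace Y]

theorem measurable_last_info (t : ℕ) :
    Measurable fun ω : Trajectory X U Y t => (ω.1 (Fin.last t), ω.2) :=
  ((measurable_pi_apply _).comp measurable_fst).prodMk measurable_snd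

/-- One step of the law of the trajectories, for functions of the last hidden state and of the
information. -/
theorem integral_law_succ (M : POMDP X U Y) (μ : Measure X) [IsProbabilityMeasure μ]
    (γ : AdmissiblePolicy Y U) (t : ℕ)
    {f : X × ((Fin (t + 1 + 1) → Y) × (Fin (t + 1) → U)) → ℝ} (hf : Measurable f) {B : ℝ}
    (hB : ∀ p, |f p| ≤ B) :
    ∫ ω, f (ω.1 (Fin.last (t + 1)), ω.2) ∂(M.law μ γ (t + 1)) =
      ∫ ω, ∫ x', ∫ y, f (x', γ.extendInfo t ω.2 y) ∂(M.chan x')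
        ∂(M.trans (ω.1 (Fin.last t), γ.act t ω.2)) ∂(M.law μ γ t) := by
  have hm : Measurable fun ω : Trajectory X U Y (t + 1) => f (ω.1 (Fin.last (t + 1)), ω.2) :=
    hf.comp (measurable_last_info (t + 1))
  have hm' := hm.comp (measurable_extendTrajectory (X := X) γ t)
  rw [law, integral_map (measurable_extendTrajectory γ t).aemeasurable hm.aestronglyMeasurable]
  refine (Measure.integral_compProd (integrable_of_abs_le hm' fun _ => hB _)).trans ?_
  refine integral_congr_ae (.of_forall fun ω => ?_)
  have hmω := hm'.comp (measurable_prodMk_left (x := ω))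
  refine (ProbabilityTheory.integral_compProd (integrable_of_abs_le hmω fun _ => hB _)).trans ?_
  simp [extendTrajectory, AdmissiblePolicy.extendInfo]

theorem integral_law_zero (M : POMDP X U Y) (μ : Measure X) [IsProbabilityMeasure μ]
    (γ : AdmissiblePolicy Y U) {f : X × ((Fin (0 + 1) → Y) × (Fin 0 → U)) → ℝ}
    (hf : Measurable f) {B : ℝ} (hB : ∀ p, |f p| ≤ B) :
    ∫ ω, f (ω.1 (Fin.last 0), ω.2) ∂(M.law μ γ 0) =
      ∫ x, ∫ y, f (x, (fun _ => y, fun i => i.elim0)) ∂(M.chan x) ∂μ := by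
  have hm : Measurable fun ω : Trajectory X U Y 0 => f (ω.1 (Fin.last 0), ω.2) :=
    hf.comp (measurable_last_info 0)
  rw [law, integral_map measurable_initTrajectory.aemeasurable hm.aestronglyMeasurable]
  exact Measure.integral_compProd
    (integrable_of_abs_le (hm.comp measurable_initTrajectory) fun _ => hB _)

/-- The tower property: the stage at time `t` is split off, and the remaining `k` stages, started at
`t + 1`, are integrated through one step of the law. Hence `t` must vary in the induction. -/
theorem sum_expectedCost_eq_integral_costToGo (M : POMDP X U Y) {β : ℝ} (hβ₀ : 0 ≤ β)
    (hβ₁ : β ≤ 1) {C : ℝ} (hC : ∀ p, |M.cost p| ≤ C) (μ : Measure X) [IsProbabilityMeasure μ]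
    (γ : AdmissiblePolicy Y U) (k t : ℕ) :
    ∑ s ∈ Finset.range k, β ^ s * M.expectedCost μ γ (t + s) =
      ∫ ω, M.costToGo β γ k t ω.2 (ω.1 (Fin.last t)) ∂(M.law μ γ t) := by
  induction k generalizing t with
  | zero => simp [costToGo]
  | succ k ih =>
    have hm : Measurable fun ω : Trajectory X U Y t => (ω.1 (Fin.last t), γ.act t ω.2) :=
      ((measurable_pi_apply _).comp measurable_fst).prodMk
        ((γ.measurable_act t).comp measurable_snd)
    have h2 : Measurable fun q : Trajectory X U Y t × X =>
        M.costToGoUnobserved β γ k t q.1.2 q.2 :=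
      (M.measurable_costToGoUnobserved β γ k t).comp
        (measurable_snd.prodMk (measurable_snd.comp measurable_fst))
    have h3 := (h2.stronglyMeasurable.integral_kernel_prod_right'
        (κ := M.trans.comap _ hm)).measurable
    simp only [Kernel.comap_apply] at h3
    have h4 : ∀ s, β ^ (s + 1) * M.expectedCost μ γ (t + (s + 1)) =
        β * (β ^ s * M.expectedCost μ γ (t + 1 + s)) := fun s => by
      rw [show t + (s + 1) = t + 1 + s by ring]; ring
    rw [Finset.sum_range_succ', Finset.sum_congr rfl fun s _ => h4 s, ← Finset.mul_sum, ih (t + 1),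
      M.integral_law_succ μ γ t (M.measurable_costToGo β γ k (t + 1))
        (fun p => M.abs_costToGo_le hβ₀ hβ₁ hC γ k (t + 1) p.2 p.1)]
    simp only [costToGo_succ]
    have h5 : Integrable (fun ω : Trajectory X U Y t => M.cost (ω.1 (Fin.last t), γ.act t ω.2))
        (M.law μ γ t) := integrable_of_abs_le (M.measurable_cost.comp hm) fun _ => hC _
    rw [integral_add h5
      ((integrable_of_abs_le h3 fun ω => abs_integral_le_of_abs_le fun x' =>
        M.abs_costToGoUnobserved_le hβ₀ hβ₁ hC γ k t ω.2 x').const_mul β),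
      integral_const_mul, add_comm]
    simp [expectedCost, costToGoUnobserved]

/-- The information before the first observation, extended by that observation. -/
def initInfo (y : Y) : (Fin (0 + 1) → Y) × (Fin 0 → U) := (fun _ => y, fun i => i.elim0)

theorem measurable_initInfo : Measurable (initInfo : Y → (Fin (0 + 1) → Y) × (Fin 0 → U)) :=
  (measurable_pi_lambda _ fun _ => measurable_id).prodMk measurable_const

theorem measurable_costToGo_initInfo (M : POMDP X U Y) (β : ℝ) (γ : AdmissiblePolicy Y U) (k : ℕ)
    (x : X) : Measurable fun y => M.costToGo β γ k 0 (initInfo y) x :=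
  (M.measurable_costToGo β γ k 0).comp (measurable_const.prodMk measurable_initInfo)

/-- The expected discounted cost of the first `k` stages when the hidden state starts in `x`. -/
noncomputable def initialCost (M : POMDP X U Y) (β : ℝ) (γ : AdmissiblePolicy Y U) (k : ℕ)
    (x : X) : ℝ :=
  ∫ y, M.costToGo β γ k 0 (initInfo y) x ∂(M.chan x)

theorem measurable_initialCost (M : POMDP X U Y) (β : ℝ) (γ : AdmissiblePolicy Y U) (k : ℕ) :
    Measurable (M.initialCost β γ k) := by
  have h : Measurable fun q : X × Y => M.costToGo β γ k 0 (initInfo q.2) q.1 :=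
    (M.measurable_costToGo β γ k 0).comp
      (measurable_fst.prodMk (measurable_initInfo.comp measurable_snd))
  exact (h.stronglyMeasurable.integral_kernel_prod_right' (κ := M.chan)).measurable

theorem abs_initialCost_le (M : POMDP X U Y) {β : ℝ} (hβ₀ : 0 ≤ β) (hβ₁ : β ≤ 1) {C : ℝ}
    (hC : ∀ p, |M.cost p| ≤ C) (γ : AdmissiblePolicy Y U) (k : ℕ) (x : X) :
    |M.initialCost β γ k x| ≤ k * C :=
  abs_integral_le_of_abs_le fun _ => M.abs_costToGo_le hβ₀ hβ₁ hC γ k 0 _ _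

theorem sum_expectedCost_eq_integral_initialCost (M : POMDP X U Y) {β : ℝ} (hβ₀ : 0 ≤ β)
    (hβ₁ : β ≤ 1) {C : ℝ} (hC : ∀ p, |M.cost p| ≤ C) (μ : Measure X) [IsProbabilityMeasure μ]
    (γ : AdmissiblePolicy Y U) (k : ℕ) :
    ∑ s ∈ Finset.range k, β ^ s * M.expectedCost μ γ s = ∫ x, M.initialCost β γ k x ∂μ := by
  have h := M.sum_expectedCost_eq_integral_costToGo hβ₀ hβ₁ hC μ γ k 0
  simp only [zero_add] at h
  rw [h, M.integral_law_zero μ γ (M.measurable_costToGo β γ k 0)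
    (fun p => M.abs_costToGo_le hβ₀ hβ₁ hC γ k 0 p.2 p.1)]
  rfl

theorem abs_expectedCost_le (M : POMDP X U Y) {C : ℝ} (hC : ∀ p, |M.cost p| ≤ C)
    (μ : Measure X) [IsProbabilityMeasure μ] (γ : AdmissiblePolicy Y U) (t : ℕ) :
    |M.expectedCost μ γ t| ≤ C :=
  abs_integral_le_of_abs_le fun _ => hC _

/-- The discounted cost is approximated by its truncation, uniformly in the policy. -/
theorem abs_discountedCost_sub_sum_le (M : POMDP X U Y) {β : ℝ} (hβ₀ : 0 ≤ β) (hβ₁ : β < 1)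
    {C : ℝ} (hC : ∀ p, |M.cost p| ≤ C) (μ : Measure X) [IsProbabilityMeasure μ]
    (γ : AdmissiblePolicy Y U) (k : ℕ) :
    |M.discountedCost β μ γ - ∑ s ∈ Finset.range k, β ^ s * M.expectedCost μ γ s| ≤
      C * β ^ k / (1 - β) := by
  have hb : ∀ s, ‖β ^ s * M.expectedCost μ γ s‖ ≤ C * β ^ s := fun s => by
    rw [norm_mul, norm_pow, Real.norm_of_nonneg hβ₀, mul_comm]
    exact mul_le_mul_of_nonneg_right (M.abs_expectedCost_le hC μ γ s) (pow_nonneg hβ₀ s)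
  have hs : Summable fun s => β ^ s * M.expectedCost μ γ s :=
    .of_norm_bounded ((summable_geometric_of_lt_one hβ₀ hβ₁).mul_left C) hb
  have h := norm_sub_le_of_geometric_bound_of_hasSum hβ₁ hb hs.hasSum k
  rwa [Real.norm_eq_abs, abs_sub_comm] at h

theorem abs_discountedCost_le (M : POMDP X U Y) {β : ℝ} (hβ₀ : 0 ≤ β) (hβ₁ : β < 1)
    {C : ℝ} (hC : ∀ p, |M.cost p| ≤ C) (μ : Measure X) [IsProbabilityMeasure μ]
    (γ : AdmissiblePolicy Y U) : |M.discountedCost β μ γ| ≤ C / (1 - β) := by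
  -- For `k = 0` the truncated sum is empty and the tail is the whole series.
  simpa using M.abs_discountedCost_sub_sum_le hβ₀ hβ₁ hC μ γ 0

end POMDP

/-! ### Integration against the discretized kernels. -/

theorem MeasureTheory.integral_bind_kernel {α γ : Type*} [MeasurableSpace α] [MeasurableSpace γ]
    (μ : Measure α) [IsProbabilityMeasure μ] (κ : Kernel α γ) [IsMarkovKernel κ]
    {f : γ → ℝ} (hf : Measurable f) {B : ℝ} (hB : ∀ a, |f a| ≤ B) :
    ∫ a, f a ∂(μ.bind κ) = ∫ x, ∫ a, f a ∂(κ x) ∂μ := by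
  have h : IsProbabilityMeasure (μ.bind κ) :=
    isProbabilityMeasure_bind κ.measurable.aemeasurable (.of_forall fun z => inferInstance)
  have hi : Integrable f (μ.bind κ) := integrable_of_abs_le hf hB
  rw [Measure.comp_eq_comp_const_apply] at hi ⊢
  rw [Kernel.integral_comp hi]
  simp

namespace Quantization

variable {X : Type*} [MeasurableSpace X]

/-- The conditional measure is carried by its cell, so closeness to `a` is needed only there. -/
theorem abs_integral_cellMeasure_sub_le [MeasurableSingletonClass X] (Q : Quantization X)
    (i : Q.points) {f : X → ℝ} (hf : Measurable f) {B : ℝ} (hB : ∀ x, |f x| ≤ B) {a ε : ℝ}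
    (h : ∀ z, Q.toPoint z = i → |f z - a| ≤ ε) : |∫ z, f z ∂(Q.cellMeasure i) - a| ≤ ε := by
  have hm : MeasurableSet (Q.toPoint ⁻¹' {i}) := Q.measurable_toPoint (measurableSet_singleton i)
  have h1 : ∫ z, f z ∂(Q.cellMeasure i) - a = ∫ z, (f z - a) ∂(Q.cellMeasure i) := by
    rw [integral_sub (integrable_of_abs_le hf hB) (integrable_const a)]
    simp
  have h2 : ∀ᵐ z ∂(Q.cellMeasure i), ‖f z - a‖ ≤ ε := (ae_cond_mem hm).mono fun z hz => h z hz
  rw [h1]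
  simpa using norm_integral_le_of_norm_le_const h2

variable {U Y : Type*} [MeasurableSpace U] [MeasurableSpace Y]
  [MeasurableSingletonClass X] [Finite U] [MeasurableSingletonClass U]

theorem integral_discretize_chan (Q : Quantization X) (M : POMDP X U Y) (i : Q.points)
    {f : Y → ℝ} (hf : Measurable f) {B : ℝ} (hB : ∀ y, |f y| ≤ B) :
    ∫ y, f y ∂((Q.discretize M).chan i) = ∫ z, ∫ y, f y ∂(M.chan z) ∂(Q.cellMeasure i) :=
  integral_bind_kernel (Q.cellMeasure i) M.chan hf hB

theorem integral_discretize_trans (Q : Quantization X) (M : POMDP X U Y) (i : Q.points) (u : U)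
    (f : Q.points → ℝ) {B : ℝ} (hB : ∀ j, |f j| ≤ B) :
    ∫ j, f j ∂((Q.discretize M).trans (i, u)) =
      ∫ z, ∫ x', f (Q.toPoint x') ∂(M.trans (z, u)) ∂(Q.cellMeasure i) := by
  have hf : Measurable f := measurable_of_finite f
  have hm : Measurable fun z : X => (z, u) := measurable_id.prodMk measurable_const
  have h := integral_bind_kernel (Q.cellMeasure i) (M.trans.comap _ hm)
    (hf.comp Q.measurable_toPoint) (fun a => hB _)
  exact (integral_map Q.measurable_toPoint.aemeasurable hf.aestronglyMeasurable).trans h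

theorem abs_discretize_cost_le (Q : Quantization X) (M : POMDP X U Y) {C : ℝ}
    (hC : ∀ p, |M.cost p| ≤ C) (p : Q.points × U) : |(Q.discretize M).cost p| ≤ C :=
  abs_integral_le_of_abs_le fun _ => hC _

end Quantization

/-! ### Equicontinuity of the costs to go in the hidden state. -/

/-- Finitely many neighbourhoods, one per action, are intersected; the action thus becomes part of
the index. -/
theorem Equicontinuous.prodMk_right_of_finite {ι X U : Type*} [TopologicalSpace X]
    [TopologicalSpace U] [Finite U] {F : ι → X × U → ℝ} (hF : Equicontinuous F) :
    Equicontinuous fun (p : ι × U) x => F p.1 (x, p.2) := by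
  intro x V hV
  have h : ∀ u, ∀ᶠ x' in 𝓝 x, ∀ i, (F i (x, u), F i (x', u)) ∈ V := fun u =>
    (Continuous.prodMk_left u).tendsto x (hF (x, u) V hV)
  filter_upwards [eventually_all.2 h] with x' hx' p
  exact hx' p.2 p.1

/-- Integrating a uniformly equicontinuous family of functions `V i y` of the state over the
observation `y`, drawn from a channel continuous in total variation, preserves uniform
equicontinuity. -/
theorem uniformEquicontinuous_integral_chan {ι X Y : Type*} [MetricSpace X] [CompactSpace X]
    [MeasurableSpace X] [MeasurableSpace Y] (κ : Kernel X Y) [IsMarkovKernel κ]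
    (hκ : ∀ x, Tendsto (fun x' => tvNorm (κ x') (κ x)) (𝓝 x) (𝓝 0))
    {V : ι → Y → X → ℝ} (hm : ∀ i x, Measurable fun y => V i y x) {B : ℝ}
    (hB : ∀ i y x, |V i y x| ≤ B)
    (hV : UniformEquicontinuous fun (p : ι × Y) x => V p.1 p.2 x) :
    UniformEquicontinuous fun i x => ∫ y, V i y x ∂(κ x) := by
  rw [Metric.uniformEquicontinuous_iff] at hV ⊢
  intro ε hε
  obtain ⟨δ₁, hδ₁, h₁⟩ := hV (ε / 2) (by positivity)
  obtain ⟨δ₂, hδ₂, h₂⟩ := Metric.uniformEquicontinuous_iff.1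
    (uniformEquicontinuous_integral_kernel κ hκ B) (ε / 2) (by positivity)
  refine ⟨min δ₁ δ₂, lt_min hδ₁ hδ₂, fun x x' hx i => ?_⟩
  -- The state in the integrand moves first, under the fixed measure `κ x`; then the measure moves
  -- while the integrand is frozen at `x'`, as one member of the class of bounded measurable
  -- functions.
  have h3 : |∫ y, V i y x ∂(κ x) - ∫ y, V i y x' ∂(κ x)| ≤ ε / 2 :=
    abs_integral_sub_integral_le (integrable_of_abs_le (hm i x) fun y => hB i y x)
      (integrable_of_abs_le (hm i x') fun y => hB i y x')
      fun y => (h₁ x x' (hx.trans_le (min_le_left _ _)) (i, y)).le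
  have h4 := h₂ x x' (hx.trans_le (min_le_right _ _)) ⟨fun y => V i y x', hm i x', fun y => hB i y x'⟩
  refine (dist_triangle _ (∫ y, V i y x' ∂(κ x)) _).trans_lt ?_
  rw [Real.dist_eq]
  linarith

namespace POMDP

section Continuity

variable {X U Y : Type*} [MetricSpace X] [CompactSpace X] [MeasurableSpace X] [MeasurableSpace U]
  [MeasurableSpace Y]

variable (Y U) in
/-- Pairs of a policy and an information vector at time `t`. -/
abbrev PolicyInfo (t : ℕ) : Type _ := AdmissiblePolicy Y U × ((Fin (t + 1) → Y) × (Fin t → U))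

theorem uniformEquicontinuous_costToGoUnobserved_of (M : POMDP X U Y)
    (hO : ∀ x, Tendsto (fun x' => tvNorm (M.chan x') (M.chan x)) (𝓝 x) (𝓝 0)) {β : ℝ}
    (hβ₀ : 0 ≤ β) (hβ₁ : β ≤ 1) {C : ℝ} (hC : ∀ p, |M.cost p| ≤ C) (k t : ℕ)
    (h : UniformEquicontinuous fun (p : PolicyInfo U Y (t + 1)) x =>
      M.costToGo β p.1 k (t + 1) p.2 x) :
    UniformEquicontinuous fun (p : PolicyInfo U Y t) x =>
      M.costToGoUnobserved β p.1 k t p.2 x :=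
  uniformEquicontinuous_integral_chan M.chan hO
    (V := fun (p : PolicyInfo U Y t) y x =>
      M.costToGo β p.1 k (t + 1) (p.1.extendInfo t p.2 y) x)
    (fun p x => M.measurable_costToGo_extendInfo β p.1 k t p.2 x)
    (fun p _ x => M.abs_costToGo_le hβ₀ hβ₁ hC p.1 k (t + 1) _ x)
    -- The extended information does not depend on `x`, so each integrand already belongs to the
    -- equicontinuous family at time `t + 1`.
    (h.comp fun q : PolicyInfo U Y t × Y => (q.1.1, q.1.1.extendInfo t q.1.2 q.2))

variable [Finite U] [TopologicalSpace U]

theorem uniformEquicontinuous_cost (M : POMDP X U Y) (hc : Continuous M.cost) :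
    UniformEquicontinuous fun (u : U) x => M.cost (x, u) := by
  have h : Equicontinuous fun (_ : Unit) => M.cost := equicontinuous_unique.2 hc
  exact CompactSpace.uniformEquicontinuous_of_equicontinuous
    (h.prodMk_right_of_finite.comp fun u => ((), u))

variable [BorelSpace X]

theorem uniformEquicontinuous_integral_trans {ι : Type*} (M : POMDP X U Y)
    (hT : Continuous M.transLaw) {F : ι → X → ℝ} (hF : Equicontinuous F) {B : ℝ}
    (hB : ∀ i x, |F i x| ≤ B) :
    UniformEquicontinuous fun (p : ι × U) x => ∫ x', F p.1 x' ∂(M.trans (x, p.2)) :=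
  CompactSpace.uniformEquicontinuous_of_equicontinuous
    (equicontinuous_integral_of_continuous hT hF hB).prodMk_right_of_finite

/-- The costs to go are uniformly equicontinuous in the hidden state, uniformly over all policies
and all information vectors. -/
theorem uniformEquicontinuous_costToGo (M : POMDP X U Y) (hc : Continuous M.cost)
    (hT : Continuous M.transLaw)
    (hO : ∀ x, Tendsto (fun x' => tvNorm (M.chan x') (M.chan x)) (𝓝 x) (𝓝 0)) {β : ℝ}
    (hβ₀ : 0 ≤ β) (hβ₁ : β ≤ 1) {C : ℝ} (hC : ∀ p, |M.cost p| ≤ C) (k t : ℕ) :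
    UniformEquicontinuous fun (p : PolicyInfo U Y t) x => M.costToGo β p.1 k t p.2 x := by
  induction k generalizing t with
  | zero =>
    rw [Metric.uniformEquicontinuous_iff]
    exact fun ε hε => ⟨1, one_pos, fun x x' _ p => by simpa [costToGo] using hε⟩
  | succ k ih =>
    have h := M.uniformEquicontinuous_integral_trans hT
      (M.uniformEquicontinuous_costToGoUnobserved_of hO hβ₀ hβ₁ hC k t (ih (t + 1))).equicontinuous
      fun p x => M.abs_costToGoUnobserved_le hβ₀ hβ₁ hC p.1 k t p.2 x
    rw [Metric.uniformEquicontinuous_iff] at h ⊢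
    intro ε hε
    obtain ⟨δ₁, hδ₁, h₁⟩ := Metric.uniformEquicontinuous_iff.1 (M.uniformEquicontinuous_cost hc)
      (ε / 2) (by positivity)
    obtain ⟨δ₂, hδ₂, h₂⟩ := h (ε / 2) (by positivity)
    refine ⟨min δ₁ δ₂, lt_min hδ₁ hδ₂, fun x x' hx p => ?_⟩
    -- Both states face the same action, since it is determined by `p` alone.
    have h3 := h₁ x x' (hx.trans_le (min_le_left _ _)) (p.1.act t p.2)
    have h4 := h₂ x x' (hx.trans_le (min_le_right _ _)) (p, p.1.act t p.2)
    simp only [costToGo_succ]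
    refine (dist_add_add_le _ _ _ _).trans_lt ?_
    rw [Real.dist_eq (β * _), ← mul_sub, abs_mul, abs_of_nonneg hβ₀]
    rw [Real.dist_eq] at h4
    have h5 := mul_le_of_le_one_left (abs_nonneg
      (∫ x', M.costToGoUnobserved β p.1 k t p.2 x' ∂(M.trans (x, p.1.act t p.2)) -
        ∫ x'', M.costToGoUnobserved β p.1 k t p.2 x'' ∂(M.trans (x', p.1.act t p.2)))) hβ₁
    linarith

end Continuity

end POMDP

/-! ### Comparison of the model with its discretizations. -/

namespace Quantization

section Compare

variable {X U Y : Type*} [MeasurableSpace X] [MeasurableSingletonClass X]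
  [Finite U] [MeasurableSpace U] [MeasurableSingletonClass U] [MeasurableSpace Y]

/-- Two errors add up: `ε₁` for exchanging the integrand at each `z` of the cell, `ε₂` for moving
the kernel from `z` to `x`. The transition kernel is treated in the same way below. -/
theorem abs_integral_discretize_chan_sub_le (Q : Quantization X) (M : POMDP X U Y) (x : X)
    {f f' : Y → ℝ} (hf : Measurable f) (hf' : Measurable f') {B : ℝ} (hB : ∀ y, |f y| ≤ B)
    (hB' : ∀ y, |f' y| ≤ B) {ε₁ ε₂ : ℝ} (h₁ : ∀ y, |f' y - f y| ≤ ε₁)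
    (h₂ : ∀ z, Q.toPoint z = Q.toPoint x →
      |∫ y, f y ∂(M.chan z) - ∫ y, f y ∂(M.chan x)| ≤ ε₂) :
    |∫ y, f' y ∂((Q.discretize M).chan (Q.toPoint x)) - ∫ y, f y ∂(M.chan x)| ≤ ε₁ + ε₂ := by
  rw [Q.integral_discretize_chan M _ hf' hB']
  refine Q.abs_integral_cellMeasure_sub_le _ (B := B)
    hf'.stronglyMeasurable.integral_kernel.measurable
    (fun z => abs_integral_le_of_abs_le hB') fun z hz => ?_
  have h3 : |∫ y, f' y ∂(M.chan z) - ∫ y, f y ∂(M.chan z)| ≤ ε₁ :=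
    abs_integral_sub_integral_le (integrable_of_abs_le hf' hB') (integrable_of_abs_le hf hB) h₁
  exact (abs_sub_le _ (∫ y, f y ∂(M.chan z)) _).trans (add_le_add h3 (h₂ z hz))

theorem abs_integral_discretize_trans_sub_le (Q : Quantization X) (M : POMDP X U Y) (x : X)
    (u : U) {g : X → ℝ} (hg : Measurable g) {g' : Q.points → ℝ} {B : ℝ} (hB : ∀ x, |g x| ≤ B)
    (hB' : ∀ i, |g' i| ≤ B) {ε₁ ε₂ : ℝ} (h₁ : ∀ x, |g' (Q.toPoint x) - g x| ≤ ε₁)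
    (h₂ : ∀ z, Q.toPoint z = Q.toPoint x →
      |∫ x', g x' ∂(M.trans (z, u)) - ∫ x', g x' ∂(M.trans (x, u))| ≤ ε₂) :
    |∫ j, g' j ∂((Q.discretize M).trans (Q.toPoint x, u)) - ∫ x', g x' ∂(M.trans (x, u))| ≤
      ε₁ + ε₂ := by
  have hm : Measurable fun x' => g' (Q.toPoint x') :=
    (measurable_of_finite g').comp Q.measurable_toPoint
  have hu : Measurable fun z : X => (z, u) := measurable_id.prodMk measurable_const
  rw [Q.integral_discretize_trans M _ u g' hB']
  refine Q.abs_integral_cellMeasure_sub_le _ (B := B)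
    (hm.stronglyMeasurable.integral_kernel (κ := M.trans.comap _ hu)).measurable
    (fun z => abs_integral_le_of_abs_le fun _ => hB' _) fun z hz => ?_
  have h3 : |∫ x', g' (Q.toPoint x') ∂(M.trans (z, u)) - ∫ x', g x' ∂(M.trans (z, u))| ≤ ε₁ :=
    abs_integral_sub_integral_le (integrable_of_abs_le hm fun _ => hB' _)
      (integrable_of_abs_le hg hB) h₁
  exact (abs_sub_le _ (∫ x', g x' ∂(M.trans (z, u))) _).trans (add_le_add h3 (h₂ z hz))

end Compare

section Fine

variable {X : Type*} [MetricSpace X] [MeasurableSpace X]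

/-- Every state is at distance less than `δ` from the point that represents it. -/
def IsFine (Q : Quantization X) (δ : ℝ) : Prop := ∀ x : X, dist x (Q.toPoint x : X) < δ

theorem IsFine.dist_lt {Q : Quantization X} {δ : ℝ} (hQ : Q.IsFine (δ / 2)) {z x : X}
    (h : Q.toPoint z = Q.toPoint x) : dist z x < δ := by
  have h1 := hQ z
  have h2 := hQ x
  rw [h] at h1
  linarith [dist_triangle_right z x (Q.toPoint x : X)]

theorem IsFine.mono {Q : Quantization X} {δ δ' : ℝ} (hQ : Q.IsFine δ) (h : δ ≤ δ') :
    Q.IsFine δ' := fun x => (hQ x).trans_le h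

end Fine

section Convergence

variable {X U Y : Type*} [MetricSpace X] [CompactSpace X] [MeasurableSpace X] [BorelSpace X]
  [Finite U] [MeasurableSpace U] [MeasurableSingletonClass U] [MeasurableSpace Y]

/-- Closeness of the discretized observed costs follows from that of the costs to go. -/
theorem exists_isFine_abs_integral_chan_sub_le {ι : Type*} (M : POMDP X U Y)
    (hO : ∀ x, Tendsto (fun x' => tvNorm (M.chan x') (M.chan x)) (𝓝 x) (𝓝 0)) (B : ℝ)
    {ε : ℝ} (hε : 0 < ε) {V : ι → Y → X → ℝ}
    {V' : ∀ Q : Quantization X, ι → Y → Q.points → ℝ}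
    (hm : ∀ i x, Measurable fun y => V i y x) (hm' : ∀ Q i x, Measurable fun y => V' Q i y x)
    (hB : ∀ i y x, |V i y x| ≤ B) (hB' : ∀ Q i y x, |V' Q i y x| ≤ B)
    (h : ∃ δ > 0, ∀ Q : Quantization X, Q.IsFine δ → ∀ i y x,
      |V' Q i y (Q.toPoint x) - V i y x| ≤ ε / 2) :
    ∃ δ > 0, ∀ Q : Quantization X, Q.IsFine δ → ∀ i x,
      |∫ y, V' Q i y (Q.toPoint x) ∂((Q.discretize M).chan (Q.toPoint x)) -
        ∫ y, V i y x ∂(M.chan x)| ≤ ε := by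
  obtain ⟨δ₁, hδ₁, h₁⟩ := h
  obtain ⟨δ₂, hδ₂, h₂⟩ := Metric.uniformEquicontinuous_iff.1
    (uniformEquicontinuous_integral_kernel M.chan hO B) (ε / 2) (by positivity)
  refine ⟨min δ₁ (δ₂ / 2), lt_min hδ₁ (by positivity), fun Q hQ i x => ?_⟩
  rw [← add_halves ε]
  exact Q.abs_integral_discretize_chan_sub_le M x (hm i x) (hm' Q i _) (fun y => hB i y x)
    (fun y => hB' Q i y _) (fun y => h₁ Q (hQ.mono (min_le_left _ _)) i y x) fun z hz =>
      (h₂ z x ((hQ.mono (min_le_right _ _)).dist_lt hz)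
        ⟨fun y => V i y x, hm i x, fun y => hB i y x⟩).le

variable [TopologicalSpace U]

/-- The costs to go of the discretized models converge to those of the original model, uniformly
over all states, policies and information vectors. -/
theorem exists_isFine_abs_costToGo_sub_le (M : POMDP X U Y) (hc : Continuous M.cost)
    (hT : Continuous M.transLaw)
    (hO : ∀ x, Tendsto (fun x' => tvNorm (M.chan x') (M.chan x)) (𝓝 x) (𝓝 0)) {β : ℝ}
    (hβ₀ : 0 ≤ β) (hβ₁ : β ≤ 1) {C : ℝ} (hC : ∀ p, |M.cost p| ≤ C) (k t : ℕ) {ε : ℝ}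
    (hε : 0 < ε) :
    ∃ δ > 0, ∀ Q : Quantization X, Q.IsFine δ → ∀ (γ : AdmissiblePolicy Y U)
      (h : (Fin (t + 1) → Y) × (Fin t → U)) (x : X),
      |(Q.discretize M).costToGo β γ k t h (Q.toPoint x) - M.costToGo β γ k t h x| ≤ ε := by
  -- The accuracy varies as well: each stage calls the hypothesis at `ε / 3 / 2`, half of the `ε /
  -- 3` allotted to the observed cost.
  induction k generalizing t ε with
  | zero => exact ⟨1, one_pos, fun Q _ γ h x => by simpa [POMDP.costToGo] using hε.le⟩
  | succ k ih =>
    obtain ⟨δ₀, hδ₀, h₀⟩ := ih (t + 1) (ε := ε / 3 / 2) (by positivity)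
    obtain ⟨δ₁, hδ₁, h₁⟩ := exists_isFine_abs_integral_chan_sub_le M hO (k * C) (ε := ε / 3)
      (by positivity)
      (V := fun (p : POMDP.PolicyInfo U Y t) y x =>
        M.costToGo β p.1 k (t + 1) (p.1.extendInfo t p.2 y) x)
      (V' := fun Q (p : POMDP.PolicyInfo U Y t) y x =>
        (Q.discretize M).costToGo β p.1 k (t + 1) (p.1.extendInfo t p.2 y) x)
      (fun p x => M.measurable_costToGo_extendInfo β p.1 k t p.2 x)
      (fun Q p x => (Q.discretize M).measurable_costToGo_extendInfo β p.1 k t p.2 x)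
      (fun p y x => M.abs_costToGo_le hβ₀ hβ₁ hC p.1 k (t + 1) _ x)
      (fun Q p y x => (Q.discretize M).abs_costToGo_le hβ₀ hβ₁ (Q.abs_discretize_cost_le M hC)
        p.1 k (t + 1) _ x)
      ⟨δ₀, hδ₀, fun Q hQ p y x => h₀ Q hQ p.1 _ x⟩
    obtain ⟨δ₂, hδ₂, h₂⟩ := Metric.uniformEquicontinuous_iff.1 (M.uniformEquicontinuous_cost hc)
      (ε / 3) (by positivity)
    -- Only the original costs to go need to be equicontinuous; nothing but boundedness and
    -- measurability is used of the discretized ones.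
    obtain ⟨δ₃, hδ₃, h₃⟩ := Metric.uniformEquicontinuous_iff.1
      (M.uniformEquicontinuous_integral_trans hT
        (M.uniformEquicontinuous_costToGoUnobserved_of hO hβ₀ hβ₁ hC k t
          (M.uniformEquicontinuous_costToGo hc hT hO hβ₀ hβ₁ hC k (t + 1))).equicontinuous
        fun p x => M.abs_costToGoUnobserved_le hβ₀ hβ₁ hC p.1 k t p.2 x) (ε / 3) (by positivity)
    -- The halves are there because two points of one cell are compared through their common
    -- representative.
    refine ⟨min δ₁ (min (δ₂ / 2) (δ₃ / 2)), by positivity, fun Q hQ γ h x => ?_⟩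
    have hQ₁ := hQ.mono (min_le_left _ _)
    have hQ₂ := hQ.mono ((min_le_right _ _).trans (min_le_left _ _))
    have hQ₃ := hQ.mono ((min_le_right _ _).trans (min_le_right _ _))
    have hu : Measurable fun z : X => (z, γ.act t h) := measurable_id.prodMk measurable_const
    have hcost : |(Q.discretize M).cost (Q.toPoint x, γ.act t h) - M.cost (x, γ.act t h)| ≤
        ε / 3 :=
      Q.abs_integral_cellMeasure_sub_le (Q.toPoint x) (M.measurable_cost.comp hu) (fun _ => hC _)
        fun z hz => (h₂ z x (hQ₂.dist_lt hz) (γ.act t h)).le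
    have htrans := Q.abs_integral_discretize_trans_sub_le M x (γ.act t h)
      (M.measurable_costToGoUnobserved_state β γ k t h)
      (fun x => M.abs_costToGoUnobserved_le hβ₀ hβ₁ hC γ k t h x)
      (fun i => (Q.discretize M).abs_costToGoUnobserved_le hβ₀ hβ₁
        (Q.abs_discretize_cost_le M hC) γ k t h i)
      (fun x' => h₁ Q hQ₁ (γ, h) x')
      (fun z hz => (h₃ z x (hQ₃.dist_lt hz) ((γ, h), γ.act t h)).le)
    rw [POMDP.costToGo_succ, POMDP.costToGo_succ, add_sub_add_comm, ← mul_sub]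
    refine (abs_add_le _ _).trans ?_
    rw [abs_mul, abs_of_nonneg hβ₀]
    have h5 := (mul_le_of_le_one_left (abs_nonneg _) hβ₁).trans htrans
    linarith

/-- The discounted costs of the discretized models converge to those of the original model,
uniformly over all policies. -/
theorem exists_isFine_abs_discountedCost_sub_le (M : POMDP X U Y) (hc : Continuous M.cost)
    (hT : Continuous M.transLaw)
    (hO : ∀ x, Tendsto (fun x' => tvNorm (M.chan x') (M.chan x)) (𝓝 x) (𝓝 0)) {β : ℝ}
    (hβ₀ : 0 ≤ β) (hβ₁ : β < 1) {C : ℝ} (hC : ∀ p, |M.cost p| ≤ C)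
    (μ : Measure X) [IsProbabilityMeasure μ] {ε : ℝ} (hε : 0 < ε) :
    ∃ δ > 0, ∀ Q : Quantization X, Q.IsFine δ → ∀ γ : AdmissiblePolicy Y U,
      |(Q.discretize M).discountedCost β (μ.map Q.toPoint) γ - M.discountedCost β μ γ| ≤ ε := by
  -- The horizon is fixed before the quantization, which is possible because both models have costs
  -- bounded by the same `C`.
  obtain ⟨k, hk⟩ : ∃ k : ℕ, C * β ^ k / (1 - β) ≤ ε / 3 := by
    have h : Tendsto (fun k : ℕ => C * β ^ k / (1 - β)) atTop (𝓝 0) := by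
      simpa using ((tendsto_pow_atTop_nhds_zero_of_lt_one hβ₀ hβ₁).const_mul C).div_const (1 - β)
    exact (h.eventually_le_const (by positivity)).exists
  obtain ⟨δ₀, hδ₀, h₀⟩ := exists_isFine_abs_costToGo_sub_le M hc hT hO hβ₀ hβ₁.le hC k 0
    (ε := ε / 3 / 2) (by positivity)
  obtain ⟨δ, hδ, h⟩ := exists_isFine_abs_integral_chan_sub_le M hO (k * C) (ε := ε / 3)
      (by positivity)
      (V := fun (γ : AdmissiblePolicy Y U) y x => M.costToGo β γ k 0 (POMDP.initInfo y) x)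
      (V' := fun Q (γ : AdmissiblePolicy Y U) y x =>
        (Q.discretize M).costToGo β γ k 0 (POMDP.initInfo y) x)
      (fun γ x => M.measurable_costToGo_initInfo β γ k x)
      (fun Q γ x => (Q.discretize M).measurable_costToGo_initInfo β γ k x)
      (fun γ y x => M.abs_costToGo_le hβ₀ hβ₁.le hC γ k 0 _ x)
      (fun Q γ y x => (Q.discretize M).abs_costToGo_le hβ₀ hβ₁.le (Q.abs_discretize_cost_le M hC)
        γ k 0 _ x)
      ⟨δ₀, hδ₀, fun Q hQ γ y x => h₀ Q hQ γ _ x⟩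
  refine ⟨δ, hδ, fun Q hQ γ => ?_⟩
  have hC' := Q.abs_discretize_cost_le M hC
  have hprob : IsProbabilityMeasure (μ.map Q.toPoint) :=
    Measure.isProbabilityMeasure_map Q.measurable_toPoint.aemeasurable
  have h1 := M.abs_discountedCost_sub_sum_le hβ₀ hβ₁ hC μ γ k
  have h2 := (Q.discretize M).abs_discountedCost_sub_sum_le hβ₀ hβ₁ hC' (μ.map Q.toPoint) γ k
  have hm := (Q.discretize M).measurable_initialCost β γ k
  rw [M.sum_expectedCost_eq_integral_initialCost hβ₀ hβ₁.le hC] at h1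
  rw [(Q.discretize M).sum_expectedCost_eq_integral_initialCost hβ₀ hβ₁.le hC',
    integral_map Q.measurable_toPoint.aemeasurable hm.aestronglyMeasurable] at h2
  have h3 : |∫ x, (Q.discretize M).initialCost β γ k (Q.toPoint x) ∂μ -
      ∫ x, M.initialCost β γ k x ∂μ| ≤ ε / 3 :=
    abs_integral_sub_integral_le
      (integrable_of_abs_le (hm.comp Q.measurable_toPoint) fun x =>
        (Q.discretize M).abs_initialCost_le hβ₀ hβ₁.le hC' γ k _)
      (integrable_of_abs_le (M.measurable_initialCost β γ k) fun x =>
        M.abs_initialCost_le hβ₀ hβ₁.le hC γ k x) fun x => h Q hQ γ x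
  have h1' := abs_le.1 (h1.trans hk)
  have h2' := abs_le.1 (h2.trans hk)
  have h3' := abs_le.1 h3
  rw [abs_le]
  constructor <;> linarith [h1'.1, h1'.2, h2'.1, h2'.2, h3'.1, h3'.2]

end Convergence

end Quantization

/-! ### Near-optimality of the discretized optimal policies. -/

theorem mainTheorem9 {X U Y : Type*}
    [MetricSpace X] [CompactSpace X] [MeasurableSpace X] [BorelSpace X]
    [Finite U] [TopologicalSpace U] [DiscreteTopology U] [MeasurableSpace U] [BorelSpace U]
    [MeasurableSpace Y]
    (M : POMDP X U Y) (μ₀ : Measure X) [IsProbabilityMeasure μ₀]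
    (β : ℝ) (hβ₀ : 0 < β) (hβ₁ : β < 1)
    (hc : Continuous M.cost) (C : ℝ) (hC : ∀ p, |M.cost p| ≤ C)
    (hT : Continuous M.transLaw)
    (hO : ∀ x, Tendsto (fun x' => tvNorm (M.chan x') (M.chan x)) (𝓝 x) (𝓝 0))
    (Q : ℕ+ → Quantization X)
    (hnet : ∀ n, (Q n).IsNet (1 / (n : ℝ)))
    (hnear : ∀ n, (Q n).IsNearestNeighbor)
    (γhat : ℕ+ → AdmissiblePolicy Y U)
    (hopt : ∀ n, ((Q n).discretize M).IsOptimal β (μ₀.map (Q n).toPoint) (γhat n)) :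
    Tendsto (fun n => M.discountedCost β μ₀ (γhat n)) atTop (𝓝 (M.optimalCost β μ₀)) := by
  have hne : Nonempty (AdmissiblePolicy Y U) := ⟨γhat 1⟩
  have hbdd : BddBelow (Set.range fun γ => M.discountedCost β μ₀ γ) := by
    refine ⟨-(C / (1 - β)), ?_⟩
    rintro _ ⟨γ, rfl⟩
    exact (abs_le.1 (M.abs_discountedCost_le hβ₀.le hβ₁ hC μ₀ γ)).1
  rw [Metric.tendsto_nhds]
  intro ε hε
  obtain ⟨δ, hδ, h⟩ := Quantization.exists_isFine_abs_discountedCost_sub_le M hc hT hO hβ₀.le hβ₁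
    hC μ₀ (ε := ε / 3) (by positivity)
  obtain ⟨N, hN⟩ := exists_nat_one_div_lt hδ
  filter_upwards [eventually_ge_atTop N.succPNat] with n hn
  have hfine : (Q n).IsFine δ := fun x => by
    obtain ⟨p, hp, hxp⟩ := hnet n x
    have hnN : ((N : ℝ) + 1) ≤ (n : ℝ) := by
      have : (N.succPNat : ℕ) ≤ (n : ℕ) := hn
      exact_mod_cast this
    exact ((hnear n x p hp).trans_lt hxp).trans_le
      ((one_div_le_one_div_of_le (by positivity) hnN).trans hN.le)
  have h1 := fun γ => abs_le.1 (h (Q n) hfine γ)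
  have hle : M.optimalCost β μ₀ ≤ M.discountedCost β μ₀ (γhat n) := ciInf_le hbdd _
  -- One `ε / 3` passes from the true cost of `γhat n` to its discretized cost, where it beats every
  -- `γ`; the other passes back to the true cost of `γ`.
  have hge : M.discountedCost β μ₀ (γhat n) - 2 * (ε / 3) ≤ M.optimalCost β μ₀ :=
    le_ciInf fun γ => by linarith [(h1 γ).2, (h1 (γhat n)).1, hopt n γ]
  rw [Real.dist_eq, abs_lt]
  constructor <;> linarith
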